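/- For $m\ge 0$ let $\mathcal P_m^0$ be the space of monic real polynomials $a_0+a_1x+\dots+a_{m-1}x^{m-1}+x^m$ of degree $m$, identified with $\mathbb R^m$ (as a smooth oriented manifold) by the coefficients $(a_0,\dots,a_{m-1})$; the product $\mathcal P_m^0\times\mathcal P_n^0$ is oriented by the coordinates $(a_0,\dots,a_{m-1},b_0,\dots,b_{n-1})$. Let $m=2k$ and $n=2l$ be even integers with $k,l\ge 0$. Then the multiplication map $$\mu^0_{m,n}:\mathcal P_m^0\times\mathcal P_n^0\to\mathcal P_{m+n}^0,\qquad (p,q)\mapsto pq,$$ is a smooth proper map, and its mapping degree is $$\deg(\mu^0_{m,n})=\binom{k+l}{k}.$$ Here the degree is the algebraic count of preimages of a regular value: regular values of $\mu^0_{m,n}$ exist, and for every regular value $\rho\in\mathcal P_{m+n}^0$ the set $\{(p,q): pq=\rho\}$ is finite and $$\sum_{(p,q):\,pq=\rho}\operatorname{sign}\det\bigl(d\mu^0_{m,n}\bigr)_{(p,q)}=\binom{k+l}{k}.$$ -/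

import Mathlib

open scoped ContDiff

noncomputable section

/-- The space of monic real polynomials of degree `m`. -/
def MonicPoly (m : ℕ) : Type :=
  {p : Polynomial ℝ // p.Monic ∧ p.natDegree = m}

namespace MonicPoly

/-- The coefficient coordinates `(a₀, …, aₘ₋₁)` of `a₀ + a₁ x + ⋯ + aₘ₋₁ xᵐ⁻¹ + xᵐ`. -/
def coords (m : ℕ) : MonicPoly m ≃ (Fin m → ℝ) :=
  (Polynomial.monicEquivDegreeLT m).trans (Polynomial.degreeLTEquiv ℝ m).toEquiv

theorem coords_apply {m : ℕ} (p : MonicPoly m) (i : Fin m) :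
    coords m p i = p.1.coeff i := by
  change p.1.eraseLead.coeff i = p.1.coeff i
  exact Polynomial.eraseLead_coeff_of_ne _ (by rw [p.2.2]; exact i.2.ne)

/-- The topology of the coefficients. -/
instance (m : ℕ) : TopologicalSpace (MonicPoly m) :=
  TopologicalSpace.induced (coords m) inferInstance

/-- The global chart of `MonicPoly m` given by the coefficients. -/
def chart (m : ℕ) : MonicPoly m ≃ₜ (Fin m → ℝ) :=
  (coords m).toHomeomorphOfIsInducing ⟨rfl⟩

/-- The global chart of `MonicPoly m × MonicPoly n` given by the coefficients
`(a₀, …, aₘ₋₁, b₀, …, bₙ₋₁)`, i.e. the one that defines the product orientation. -/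
def prodChart (m n : ℕ) : MonicPoly m × MonicPoly n ≃ₜ (Fin (m + n) → ℝ) :=
  ((chart m).prodCongr (chart n)).trans (Fin.appendHomeomorph m n)

/-- Multiplication of monic polynomials of degrees `m` and `n`. -/
def mul (m n : ℕ) (pq : MonicPoly m × MonicPoly n) : MonicPoly (m + n) :=
  ⟨pq.1.1 * pq.2.1, pq.1.2.1.mul pq.2.2.1, by
    rw [pq.1.2.1.natDegree_mul pq.2.2.1, pq.1.2.2, pq.2.2.2]⟩

end MonicPoly

section Degree

variable {M N E : Type*} [TopologicalSpace M] [TopologicalSpace N]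
  [NormedAddCommGroup E] [NormedSpace ℝ E]

/-- The expression of `f : M → N` in the global charts `φ` and `ψ`. -/
def inCharts (φ : M ≃ₜ E) (ψ : N ≃ₜ E) (f : M → N) : E → E :=
  fun v => ψ (f (φ.symm v))

/-- The Jacobian determinant of `f` at `x` in the charts `φ` and `ψ`. -/
def jacobian (φ : M ≃ₜ E) (ψ : N ≃ₜ E) (f : M → N) (x : M) : ℝ :=
  (fderiv ℝ (inCharts φ ψ f) (φ x)).det

/-- `z` is a regular value of `f`: the differential of `f` is invertible at every point of
the preimage of `z` (which may be empty). -/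
def IsRegularValue (φ : M ≃ₜ E) (ψ : N ≃ₜ E) (f : M → N) (z : N) : Prop :=
  ∀ x : M, f x = z → jacobian φ ψ f x ≠ 0

/-- `f : M → N` is a smooth proper map of mapping degree `d`. Here `M` and `N` are
manifolds with global charts `φ`, `ψ` onto the same finite-dimensional space `E`, oriented by
these charts. The degree is the number of points, counted with the sign of the Jacobian
determinant, in the preimage of a regular value; it is required to be the same for all regular
values, and regular values are required to exist. -/
structure HasMappingDegree [FiniteDimensional ℝ E] (φ : M ≃ₜ E) (ψ : N ≃ₜ E)
    (f : M → N) (d : ℤ) : Prop where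
  smooth : ContDiff ℝ ∞ (inCharts φ ψ f)
  proper : IsProperMap f
  exists_regular : ∃ z, IsRegularValue φ ψ f z
  count : ∀ z, IsRegularValue φ ψ f z →
    ∃ h : {x : M | f x = z}.Finite,
      ∑ x ∈ h.toFinset, ((SignType.sign (jacobian φ ψ f x) : SignType) : ℤ) = d

theorem HasMappingDegree.unique [FiniteDimensional ℝ E] {φ : M ≃ₜ E} {ψ : N ≃ₜ E}
    {f : M → N} {d d' : ℤ}
    (h : HasMappingDegree φ ψ f d) (h' : HasMappingDegree φ ψ f d') : d = d' := by
  obtain ⟨z, hz⟩ := h.exists_regular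
  obtain ⟨_, e⟩ := h.count z hz
  obtain ⟨_, e'⟩ := h'.count z hz
  exact e.symm.trans e'

end Degree

end

/-!
In the coefficient charts the differential of multiplication at `(p, q)` is the map
`(h, k) ↦ h * q + p * k`, whose matrix is the Sylvester matrix of `p` and `q`. The Jacobian is thus
the resultant `Res(p, q)` (`jacobian_mul`), and `ρ` is a regular value exactly when in every
factorization `ρ = p * q` of the given degrees the factors are coprime.

For such a `ρ` of degree `2 * n`, the count of the factorizations with `deg p = 2 * k`, weighted by
the sign of `Res(p, q)`, satisfies Pascal's recursion (`signedCount_quadratic_mul`). Split off a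
quadratic factor `Q`, writing `ρ = Q * τ`, where `Q` has a pair of conjugate non-real roots if `ρ`
has no real root, and otherwise `Q = (X - a) * (X - b)` with `a ≤ b` the two smallest real roots of
`ρ`. Then `Res(Q, S) > 0` for every divisor `S` of `τ` coprime to `Q`: it is `|S(z)|²` in the first
case and `S(a) * S(b)` in the second, where `S` has no zero between `a` and `b`. So the
factorizations of `ρ` with `Q ∣ p`, respectively `Q ∣ q`, contribute the counts for `τ` with `k - 1`,
respectively `k`. The remaining ones, in which `a` and `b` are roots of different factors, cancel in
pairs: exchanging the neighbouring roots `a` and `b` reverses the sign of the resultant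
(`resultantSign_swap`). Only coprimality is used, so regular values with a double root need no
separate treatment.

Properness follows from the multiplicativity of the Mahler measure, which bounds the coefficients
of a monic factor by those of the product. Regular values exist because a separable `ρ` is one.
-/

open Polynomial
open scoped ContDiff

namespace MonicPoly

/-! ### The Jacobian of multiplication -/

/-- The linear part of the `j`-th coefficient as a function of the coordinates `v` of a monic
polynomial of degree `m`: the coordinate `v j` if `j < m`, and `0` otherwise. -/
def coeffCLM (m j : ℕ) : (Fin m → ℝ) →L[ℝ] ℝ :=
  if h : j < m then ContinuousLinearMap.proj ⟨j, h⟩ else 0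

theorem coeffCLM_single {m : ℕ} (i : Fin m) (j : ℕ) :
    coeffCLM m j (Pi.single i 1) = (X ^ (i : ℕ) : ℝ[X]).coeff j := by
  rw [coeffCLM, coeff_X_pow]
  split_ifs with h h' h'
  · subst h'; simp
  · simp [Fin.ext_iff, h']
  · exact absurd i.2 (h' ▸ h)
  · simp

theorem coeff_chart_symm {m : ℕ} (v : Fin m → ℝ) (j : ℕ) :
    ((chart m).symm v).1.coeff j = coeffCLM m j v + (X ^ m : ℝ[X]).coeff j := by
  set p := (chart m).symm v with hp
  have hv : coords m p = v := (chart m).apply_symm_apply v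
  rw [coeffCLM, coeff_X_pow]
  rcases lt_trichotomy j m with h | h | h
  · have := coords_apply p ⟨j, h⟩
    simp [h, h.ne, ← this, hv]
  · subst h
    have := p.2.1.coeff_natDegree
    rw [p.2.2] at this
    simp [this]
  · rw [coeff_eq_zero_of_natDegree_lt (by rw [p.2.2]; exact h)]
    simp [h.not_gt, h.ne']

theorem prodChart_symm (m n : ℕ) (v : Fin (m + n) → ℝ) :
    (prodChart m n).symm v = ((chart m).symm fun i => v (Fin.castAdd n i),
      (chart n).symm fun i => v (Fin.natAdd m i)) := by
  rw [Homeomorph.symm_apply_eq]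
  simp only [prodChart, Homeomorph.trans_apply, Homeomorph.coe_prodCongr, Prod.map_apply,
    Homeomorph.apply_symm_apply]
  exact (Fin.append_castAdd_natAdd (f := v)).symm

/-- The first `m` of `m + n` coordinates. -/
def fstCLM (m n : ℕ) : (Fin (m + n) → ℝ) →L[ℝ] (Fin m → ℝ) :=
  ContinuousLinearMap.pi fun i => ContinuousLinearMap.proj (Fin.castAdd n i)

/-- The last `n` of `m + n` coordinates. -/
def sndCLM (m n : ℕ) : (Fin (m + n) → ℝ) →L[ℝ] (Fin n → ℝ) :=
  ContinuousLinearMap.pi fun i => ContinuousLinearMap.proj (Fin.natAdd m i)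

theorem inCharts_mul_apply (m n : ℕ) (v : Fin (m + n) → ℝ) (i : Fin (m + n)) :
    inCharts (prodChart m n) (chart (m + n)) (mul m n) v i =
      ∑ s ∈ Finset.HasAntidiagonal.antidiagonal (i : ℕ),
        (coeffCLM m s.1 (fstCLM m n v) + (X ^ m : ℝ[X]).coeff s.1) *
          (coeffCLM n s.2 (sndCLM m n v) + (X ^ n : ℝ[X]).coeff s.2) := by
  have h : inCharts (prodChart m n) (chart (m + n)) (mul m n) v i =
      (mul m n ((prodChart m n).symm v)).1.coeff i := coords_apply _ i
  rw [h, prodChart_symm, mul, coeff_mul]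
  simp only [coeff_chart_symm]
  rfl

theorem contDiff_inCharts_mul (m n : ℕ) :
    ContDiff ℝ ∞ (inCharts (prodChart m n) (chart (m + n)) (mul m n)) := by
  rw [contDiff_pi]
  intro i
  simp only [inCharts_mul_apply]
  fun_prop

/-- The partial derivatives of the coefficients of `p * q` with respect to those of `p` and `q`
are the entries of the Sylvester matrix of `p` and `q`. -/
theorem jacobian_mul (m n : ℕ) (x : MonicPoly m × MonicPoly n) :
    jacobian (prodChart m n) (chart (m + n)) (mul m n) x = resultant x.1.1 x.2.1 := by
  obtain ⟨v, rfl⟩ := (prodChart m n).symm.surjective x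
  -- `resultant` takes the formal degrees from `natDegree` by default.
  have hd : resultant ((prodChart m n).symm v).1.1 ((prodChart m n).symm v).2.1 =
      resultant ((prodChart m n).symm v).1.1 ((prodChart m n).symm v).2.1 m n := by
    rw [((prodChart m n).symm v).1.2.2, ((prodChart m n).symm v).2.2.2]
  rw [hd, jacobian, Homeomorph.apply_symm_apply, resultant, ContinuousLinearMap.det,
    ← LinearMap.det_toMatrix']
  congr 1
  have hq : ((prodChart m n).symm v).2.1.natDegree = n := ((prodChart m n).symm v).2.2.2
  have hp : ((prodChart m n).symm v).1.1.natDegree = m := ((prodChart m n).symm v).1.2.2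
  rw [prodChart_symm] at hp hq ⊢
  set p := (chart m).symm fun i => v (Fin.castAdd n i) with hpd
  set q := (chart n).symm fun i => v (Fin.natAdd m i) with hqd
  replace hq : q.1.natDegree = n := hq
  replace hp : p.1.natDegree = m := hp
  have hpc (s : ℕ) : coeffCLM m s (fstCLM m n v) + (X ^ m : ℝ[X]).coeff s = p.1.coeff s :=
    (coeff_chart_symm _ _).symm
  have hqc (s : ℕ) : coeffCLM n s (sndCLM m n v) + (X ^ n : ℝ[X]).coeff s = q.1.coeff s :=
    (coeff_chart_symm _ _).symm
  ext i j
  have hderiv := HasFDerivAt.fun_sum (x := v)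
    (u := Finset.HasAntidiagonal.antidiagonal (i : ℕ)) (fun s _ =>
    ((((coeffCLM m s.1).comp (fstCLM m n)).hasFDerivAt (x := v)).add_const
      ((X ^ m : ℝ[X]).coeff s.1)).mul
    ((((coeffCLM n s.2).comp (sndCLM m n)).hasFDerivAt (x := v)).add_const
      ((X ^ n : ℝ[X]).coeff s.2)))
  have hdiff := ((contDiff_inCharts_mul m n).differentiable (by simp)) v
  -- The entry of the Jacobian matrix in row `i` and column `j`, by the product rule.
  have key : fderiv ℝ (inCharts (prodChart m n) (chart (m + n)) (mul m n)) v (Pi.single j 1) i =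
      ∑ s ∈ Finset.HasAntidiagonal.antidiagonal (i : ℕ),
        (p.1.coeff s.1 * coeffCLM n s.2 (sndCLM m n (Pi.single j 1)) +
         q.1.coeff s.2 * coeffCLM m s.1 (fstCLM m n (Pi.single j 1))) := by
    have h1 := (hasFDerivAt_pi'.1 hdiff.hasFDerivAt) i
    simp only [inCharts_mul_apply] at h1
    have h2 := congrArg (fun A => A (Pi.single j 1)) (h1.unique hderiv)
    simp only [ContinuousLinearMap.comp_apply, ContinuousLinearMap.proj_apply,
      _root_.sum_apply, _root_.add_apply,
      _root_.smul_apply, smul_eq_mul, hpc, hqc] at h2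
    exact h2
  rw [LinearMap.toMatrix'_apply]
  refine key.trans ?_
  induction j using Fin.addCases with
  | left j =>
    have h1 : fstCLM m n (Pi.single (Fin.castAdd n j) 1) = Pi.single j 1 := by
      ext i'; simp [fstCLM, Pi.single_apply]
    have h2 : sndCLM m n (Pi.single (Fin.castAdd n j) 1) = 0 := by
      ext i'; simp [sndCLM, Pi.single_apply, Fin.ext_iff]; omega
    simp only [h1, h2, map_zero, mul_zero, zero_add, coeffCLM_single, mul_comm (q.1.coeff _),
      ← coeff_mul, coeff_X_pow_mul', sylvester, Matrix.of_apply, Fin.addCases_left, Set.mem_Icc]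
    split_ifs with h3 h4 h4
    · rfl
    · exact coeff_eq_zero_of_natDegree_lt (by omega)
    · omega
    · rfl
  | right j =>
    have h1 : fstCLM m n (Pi.single (Fin.natAdd m j) 1) = 0 := by
      ext i'; simp [fstCLM, Pi.single_apply, Fin.ext_iff]; omega
    have h2 : sndCLM m n (Pi.single (Fin.natAdd m j) 1) = Pi.single j 1 := by
      ext i'; simp [sndCLM, Pi.single_apply]
    simp only [h1, h2, map_zero, mul_zero, add_zero, coeffCLM_single,
      ← coeff_mul, coeff_mul_X_pow', sylvester, Matrix.of_apply, Fin.addCases_right, Set.mem_Icc]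
    split_ifs with h3 h4 h4
    · rfl
    · exact coeff_eq_zero_of_natDegree_lt (by omega)
    · omega
    · rfl

/-! ### Properness -/

/-- The Mahler measure is multiplicative and at least `1` on monic polynomials, so that of `p` is at
most that of `p * q`. -/
theorem abs_coeff_le_of_monic_mul {p q : ℝ[X]} (hq : q.Monic) (i : ℕ) :
    |p.coeff i| ≤ p.natDegree.choose i * (p * q).sum fun _ a => ‖a‖ := by
  have hv : Isometry (algebraMap ℝ ℂ) := Complex.isometry_ofReal
  have h1 := norm_coeff_le_choose_mul_mapMahlerMeasure (algebraMap ℝ ℂ) hv i p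
  have h2 := mapMahlerMeasure_le_sum_norm_coeff (p * q) (algebraMap ℝ ℂ) hv
  have h3 := hq.one_le_mapMahlerMeasure (algebraMap ℝ ℂ) hv
  rw [mapMahlerMeasure_mul] at h2
  have h4 := le_mul_of_one_le_right (mapMahlerMeasure_nonneg p (algebraMap ℝ ℂ)) h3
  exact h1.trans (by gcongr; exact h4.trans h2)

theorem sum_norm_coeff_le {m : ℕ} (p : MonicPoly m) :
    (p.1.sum fun _ a => ‖a‖) ≤ m * ‖chart m p‖ + 1 := by
  rw [sum_over_range _ (by simp), p.2.2, Finset.sum_range_succ]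
  have h : p.1.coeff m = 1 := by have := p.2.1.coeff_natDegree; rwa [p.2.2] at this
  rw [h, norm_one]
  gcongr
  refine (Finset.sum_le_card_nsmul _ _ ‖chart m p‖ fun i hi => ?_).trans (by simp)
  rw [← coords_apply p ⟨i, Finset.mem_range.1 hi⟩]
  exact norm_le_pi_norm (chart m p) ⟨i, Finset.mem_range.1 hi⟩

theorem norm_chart_le {m N : ℕ} (p : MonicPoly m) {q : ℝ[X]} (hq : q.Monic) (r : MonicPoly N)
    (h : p.1 * q = r.1) : ‖chart m p‖ ≤ 2 ^ m * (N * ‖chart N r‖ + 1) := by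
  rw [pi_norm_le_iff_of_nonneg (by positivity)]
  intro i
  have h1 := abs_coeff_le_of_monic_mul (p := p.1) hq i
  rw [h, p.2.2] at h1
  have h2 := sum_norm_coeff_le r
  have h3 : chart m p i = p.1.coeff i := coords_apply p i
  rw [h3]
  refine h1.trans ?_
  gcongr
  · exact Finset.sum_nonneg fun _ _ => norm_nonneg _
  · exact_mod_cast Nat.choose_le_two_pow m i

theorem continuous_mul (m n : ℕ) : Continuous (mul m n) := by
  have h := (contDiff_inCharts_mul m n).continuous
  have e : mul m n = (chart (m + n)).symm ∘ inCharts (prodChart m n) (chart (m + n)) (mul m n) ∘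
      prodChart m n := by
    ext1 x; simp [inCharts]
  rw [e]
  fun_prop

theorem isProperMap_mul (m n : ℕ) : IsProperMap (mul m n) := by
  have : T2Space (MonicPoly (m + n)) := (chart (m + n)).symm.t2Space
  have : LocallyCompactSpace (MonicPoly (m + n)) :=
    (chart (m + n)).isOpenEmbedding.locallyCompactSpace
  rw [isProperMap_iff_isCompact_preimage]
  refine ⟨continuous_mul m n, fun K hK => ?_⟩
  obtain ⟨B, hB⟩ := (hK.image (chart (m + n)).continuous).isBounded.exists_norm_le
  set R : ℕ → ℝ := fun d => 2 ^ d * ((m + n : ℕ) * B + 1)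
  have hc : IsCompact (((chart m).prodCongr (chart n)) ⁻¹'
      (Metric.closedBall 0 (R m) ×ˢ Metric.closedBall 0 (R n))) :=
    ((chart m).prodCongr (chart n)).isCompact_preimage.2
      ((isCompact_closedBall _ _).prod (isCompact_closedBall _ _))
  refine hc.of_isClosed_subset (hK.isClosed.preimage (continuous_mul m n)) ?_
  rintro ⟨p, q⟩ hpq
  have hb : ‖chart (m + n) (mul m n (p, q))‖ ≤ B := hB _ ⟨_, hpq, rfl⟩
  have h1 := norm_chart_le p q.2.1 (mul m n (p, q)) rfl
  have h2 := norm_chart_le q p.2.1 (mul m n (p, q)) (mul_comm q.1 p.1)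
  constructor <;> rw [mem_closedBall_zero_iff]
  · exact h1.trans (by simp only [R]; gcongr)
  · exact h2.trans (by simp only [R]; gcongr)

/-! ### Factorizations into two monic factors -/

/-- The set of factorizations `ρ = p * q` into monic factors with `p` of degree `m`. -/
def factorizations (ρ : ℝ[X]) (m : ℕ) : Set (ℝ[X] × ℝ[X]) :=
  {x | (x.1.Monic ∧ x.2.Monic ∧ x.1 * x.2 = ρ) ∧ x.1.natDegree = m}

/-- A monic polynomial is determined by the multiset of its normalized irreducible factors. -/
theorem finite_setOf_monic_mul_eq {ρ : ℝ[X]} (hρ : ρ ≠ 0) :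
    {x : ℝ[X] × ℝ[X] | x.1.Monic ∧ x.2.Monic ∧ x.1 * x.2 = ρ}.Finite := by
  classical
  open UniqueFactorizationMonoid in
  refine Set.Finite.of_injOn (f := fun x => normalizedFactors x.1)
    (t := Set.Iic (normalizedFactors ρ)) ?_ ?_ (Set.finite_Iic _)
  · rintro ⟨p, q⟩ ⟨hp, hq, rfl⟩
    exact (dvd_iff_normalizedFactors_le_normalizedFactors hp.ne_zero hρ).1 (dvd_mul_right p q)
  · rintro ⟨p, q⟩ ⟨hp, hq, h⟩ ⟨p', q'⟩ ⟨hp', hq', h'⟩ he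
    have key : ∀ r : ℝ[X], r.Monic → (normalizedFactors r).prod = r := fun r hr => by
      rw [prod_normalizedFactors_eq hr.ne_zero, hr.normalize_eq_self]
    obtain rfl : p = p' := by rw [← key p hp, ← key p' hp']; exact congrArg _ he
    obtain rfl : q = q' := mul_left_cancel₀ hp.ne_zero (h.trans h'.symm)
    rfl

/-- The sign of the resultant of a pair of polynomials, as an integer. -/
noncomputable def resultantSign (x : ℝ[X] × ℝ[X]) : ℤ :=
  ((SignType.sign (resultant x.1 x.2) : SignType) : ℤ)

theorem finite_factorizations {ρ : ℝ[X]} (hρ : ρ ≠ 0) (m : ℕ) : (factorizations ρ m).Finite :=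
  (finite_setOf_monic_mul_eq hρ).subset fun _ h => h.1

/-- The number of factorizations `ρ = p * q` into monic factors with `p` of degree `m`, counted
with the sign of the resultant. For `ρ ≠ 0` the sum is finite. -/
noncomputable def signedCount (ρ : ℝ[X]) (m : ℕ) : ℤ := ∑ᶠ x ∈ factorizations ρ m, resultantSign x

theorem mul_left_mem_factorizations {Q τ : ℝ[X]} (hQ : Q.Monic) {d : ℕ} (hd : Q.natDegree = d)
    {m : ℕ} {x : ℝ[X] × ℝ[X]} (hx : x ∈ factorizations τ m) :
    (Q * x.1, x.2) ∈ factorizations (Q * τ) (m + d) := by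
  obtain ⟨⟨hp, hq, h⟩, hm⟩ := hx
  refine ⟨⟨hQ.mul hp, hq, ?_⟩, ?_⟩
  · simp only; rw [← h, mul_assoc]
  · simp only; rw [hQ.natDegree_mul hp, hm, hd, add_comm]

theorem mul_right_mem_factorizations {Q τ : ℝ[X]} (hQ : Q.Monic) {m : ℕ} {x : ℝ[X] × ℝ[X]}
    (hx : x ∈ factorizations τ m) : (x.1, Q * x.2) ∈ factorizations (Q * τ) m := by
  obtain ⟨⟨hp, hq, h⟩, hm⟩ := hx
  refine ⟨⟨hp, hQ.mul hq, ?_⟩, hm⟩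
  simp only; rw [← h, mul_left_comm]

theorem mul_mul_mem_factorizations {τ : ℝ[X]} (c d : ℝ) {m : ℕ} {x : ℝ[X] × ℝ[X]}
    (hx : x ∈ factorizations τ (m + 1)) :
    ((X - C c) * x.1, (X - C d) * x.2) ∈
      factorizations ((X - C c) * (X - C d) * τ) (m + 2) := by
  rw [mul_assoc]
  exact mul_left_mem_factorizations (monic_X_sub_C c) (natDegree_X_sub_C c)
    (mul_right_mem_factorizations (monic_X_sub_C d) hx)

theorem factorizations_mul_left {Q τ : ℝ[X]} (hQ : Q.Monic) {d : ℕ}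
    (hd : Q.natDegree = d) (m : ℕ) :
    {x ∈ factorizations (Q * τ) (m + d) | Q ∣ x.1} =
      (fun x => (Q * x.1, x.2)) '' factorizations τ m := by
  ext ⟨p, q⟩
  constructor
  · rintro ⟨⟨⟨hp, hq, h⟩, hm⟩, P, rfl⟩
    have hP := hQ.of_mul_monic_left hp
    simp only [hQ.natDegree_mul hP] at hm
    simp only [mul_assoc] at h
    exact ⟨(P, q), ⟨⟨hP, hq, mul_left_cancel₀ hQ.ne_zero h⟩, by simp only; omega⟩, rfl⟩
  · rintro ⟨x, hx, he⟩
    rw [← he]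
    exact ⟨mul_left_mem_factorizations hQ hd hx, dvd_mul_right _ _⟩

theorem factorizations_mul_right {Q τ : ℝ[X]} (hQ : Q.Monic) (m : ℕ) :
    {x ∈ factorizations (Q * τ) m | Q ∣ x.2} =
      (fun x => (x.1, Q * x.2)) '' factorizations τ m := by
  ext ⟨p, q⟩
  constructor
  · rintro ⟨⟨⟨hp, hq, h⟩, hm⟩, R, rfl⟩
    have hR := hQ.of_mul_monic_left hq
    simp only [mul_left_comm p Q] at h
    exact ⟨(p, R), ⟨⟨hp, hR, mul_left_cancel₀ hQ.ne_zero h⟩, hm⟩, rfl⟩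
  · rintro ⟨x, hx, he⟩
    rw [← he]
    exact ⟨mul_right_mem_factorizations hQ hx, dvd_mul_right _ _⟩

/-! ### Signs of resultants -/

theorem resultant_mul_left_of_monic (f₁ f₂ g : ℝ[X]) (h₁ : f₁.Monic) (h₂ : f₂.Monic) :
    resultant (f₁ * f₂) g = resultant f₁ g * resultant f₂ g := by
  rw [h₁.natDegree_mul h₂, resultant_mul_left _ _ _ _ le_rfl]

theorem resultant_mul_right_of_monic (f g₁ g₂ : ℝ[X]) (h₁ : g₁.Monic) (h₂ : g₂.Monic) :
    resultant f (g₁ * g₂) = resultant f g₁ * resultant f g₂ := by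
  rw [h₁.natDegree_mul h₂, resultant_mul_right _ _ _ _ le_rfl]

theorem resultant_X_sub_C_left_natDegree (a : ℝ) (g : ℝ[X]) : resultant (X - C a) g = g.eval a := by
  rw [natDegree_X_sub_C, resultant_X_sub_C_left _ _ _ le_rfl]

theorem resultant_X_sub_C_right_natDegree (a : ℝ) (f : ℝ[X]) :
    resultant f (X - C a) = (-1) ^ f.natDegree * f.eval a := by
  rw [natDegree_X_sub_C, resultant_X_sub_C_right _ _ _ le_rfl]

theorem resultantSign_mul_left {Q P R : ℝ[X]} (hQ : Q.Monic) (hP : P.Monic)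
    (h : 0 < resultant Q R) : resultantSign (Q * P, R) = resultantSign (P, R) := by
  simp only [resultantSign]
  rw [resultant_mul_left_of_monic _ _ _ hQ hP, sign_mul, sign_pos h, one_mul]

theorem resultantSign_mul_right {Q P R : ℝ[X]} (hQ : Q.Monic) (hR : R.Monic)
    (hd : Q.natDegree = 2) (h : 0 < resultant Q P) :
    resultantSign (P, Q * R) = resultantSign (P, R) := by
  -- `Res(P, Q) = Res(Q, P)` because `Q` has even degree.
  have h' : 0 < resultant P Q := by
    rw [resultant_comm, hd, pow_mul']; simpa [hd] using h
  simp only [resultantSign]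
  rw [resultant_mul_right_of_monic _ _ _ hQ hR, sign_mul, sign_pos h', one_mul]

theorem eval_mul_eval_pos {R : ℝ[X]} {a b : ℝ} (hab : a ≤ b)
    (h : ∀ x ∈ Set.Icc a b, R.eval x ≠ 0) : 0 < R.eval a * R.eval b := by
  have ha := h a ⟨le_rfl, hab⟩
  have hb := h b ⟨hab, le_rfl⟩
  by_contra hn
  have hlt : R.eval a * R.eval b < 0 := lt_of_le_of_ne (not_lt.1 hn) (mul_ne_zero ha hb)
  have hc : ContinuousOn (fun x => R.eval x) (Set.Icc a b) := R.continuous.continuousOn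
  rcases mul_neg_iff.1 hlt with ⟨h1, h2⟩ | ⟨h1, h2⟩
  · obtain ⟨x, hx, hx0⟩ := intermediate_value_Icc' hab hc ⟨h2.le, h1.le⟩
    exact h x hx hx0
  · obtain ⟨x, hx, hx0⟩ := intermediate_value_Icc hab hc ⟨h1.le, h2.le⟩
    exact h x hx hx0

theorem eval_ne_zero_of_isCoprime {p q : ℝ[X]} (h : IsCoprime p q) {a : ℝ} (hp : p.eval a = 0) :
    q.eval a ≠ 0 := by
  obtain ⟨u, v, e⟩ := h
  intro hq
  simpa [hp, hq] using congrArg (eval a) e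

theorem not_isCoprime_of_dvd {Q p q : ℝ[X]} (hQ : Q.natDegree ≠ 0) (h₁ : Q ∣ p) (h₂ : Q ∣ q) :
    ¬ IsCoprime p q := fun h => hQ (natDegree_eq_zero_of_isUnit (h.isUnit_of_dvd' h₁ h₂))

/-- Exchanging the neighbouring roots `a` and `b` between the two factors reverses the sign. -/
theorem resultantSign_swap {P R : ℝ[X]} {a b : ℝ} (hP : P.Monic) (hR : R.Monic) (hab : a ≤ b)
    (hPz : ∀ x ∈ Set.Ioo a b, P.eval x ≠ 0) (hRz : ∀ x ∈ Set.Ioo a b, R.eval x ≠ 0)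
    (h₁ : IsCoprime ((X - C a) * P) ((X - C b) * R))
    (h₂ : IsCoprime ((X - C b) * P) ((X - C a) * R)) :
    resultantSign ((X - C a) * P, (X - C b) * R) +
      resultantSign ((X - C b) * P, (X - C a) * R) = 0 := by
  have hRa : R.eval a ≠ 0 := fun h => eval_ne_zero_of_isCoprime h₁ (a := a) (by simp) (by simp [h])
  have hPb : P.eval b ≠ 0 := fun h =>
    eval_ne_zero_of_isCoprime h₁.symm (a := b) (by simp) (by simp [h])
  have hRb : R.eval b ≠ 0 := fun h => eval_ne_zero_of_isCoprime h₂ (a := b) (by simp) (by simp [h])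
  have hPa : P.eval a ≠ 0 := fun h =>
    eval_ne_zero_of_isCoprime h₂.symm (a := a) (by simp) (by simp [h])
  have hne : a ≠ b := fun h => eval_ne_zero_of_isCoprime h₁ (a := a) (by simp) (by simp [h])
  -- The factors `P` and `R` have no zero on the closed interval, hence no change of sign.
  have key : ∀ S : ℝ[X], S.eval a ≠ 0 → S.eval b ≠ 0 → (∀ x ∈ Set.Ioo a b, S.eval x ≠ 0) →
      0 < S.eval a * S.eval b := fun S ha hb h => eval_mul_eval_pos hab fun x hx => by
    rcases eq_or_lt_of_le hx.1 with rfl | h1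
    · exact ha
    rcases eq_or_lt_of_le hx.2 with rfl | h2
    · exact hb
    exact h x ⟨h1, h2⟩
  have kP := key P hPa hPb hPz
  have kR := key R hRa hRb hRz
  have hPR : resultant P R ≠ 0 :=
    resultant_ne_zero _ _ (h₁.of_mul_left_right.of_mul_right_right)
  have expand : ∀ c d : ℝ, resultant ((X - C c) * P) ((X - C d) * R) =
      (c - d) * R.eval c * ((-1) ^ P.natDegree * P.eval d * resultant P R) := fun c d => by
    rw [resultant_mul_left_of_monic _ _ _ (monic_X_sub_C c) hP,
      resultant_mul_right_of_monic _ _ _ (monic_X_sub_C d) hR,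
      resultant_mul_right_of_monic _ _ _ (monic_X_sub_C d) hR,
      resultant_X_sub_C_left_natDegree, resultant_X_sub_C_left_natDegree,
      resultant_X_sub_C_right_natDegree]
    simp
  have hneg : resultant ((X - C a) * P) ((X - C b) * R) *
      resultant ((X - C b) * P) ((X - C a) * R) < 0 := by
    rw [expand, expand]
    have h1 : ((-1 : ℝ) ^ P.natDegree) ^ 2 = 1 := by rw [← pow_mul, mul_comm, pow_mul]; simp
    have h2 : 0 < (a - b) ^ 2 := by have := sub_ne_zero.2 hne; positivity
    have h3 : 0 < resultant P R ^ 2 := by positivity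
    have : 0 < (a - b) ^ 2 * resultant P R ^ 2 * ((P.eval a * P.eval b) * (R.eval a * R.eval b)) :=
      by positivity
    linear_combination this - (a - b) ^ 2 * resultant P R ^ 2 *
      ((P.eval a * P.eval b) * (R.eval a * R.eval b)) * h1
  simp only [resultantSign]
  rcases mul_neg_iff.1 hneg with ⟨h1, h2⟩ | ⟨h1, h2⟩ <;> simp [sign_pos, sign_neg, h1, h2]

/-- The quadratic polynomial is `(X - z) * (X - conj z)`, and `R(conj z)` is conjugate to `R(z)`. -/
theorem resultant_complexQuadratic (z : ℂ) (R : ℝ[X]) :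
    resultant (X ^ 2 - C (2 * z.re) * X + C (‖z‖ ^ 2)) R = ‖aeval z R‖ ^ 2 := by
  have hmap : map (algebraMap ℝ ℂ) (X ^ 2 - C (2 * z.re) * X + C (‖z‖ ^ 2)) =
      (X - C (starRingEnd ℂ z)) * (X - C z) := by
    calc
      _ = X ^ 2 - C (↑(2 * z.re) : ℂ) * X + C (‖z‖ ^ 2 : ℂ) := by simp
      _ = (X - C (starRingEnd ℂ z)) * (X - C z) := by
        rw [← Complex.add_conj, map_add, ← Complex.mul_conj', map_mul]
        ring
  have hd : (X ^ 2 - C (2 * z.re) * X + C (‖z‖ ^ 2)).natDegree = 2 := by compute_degree!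
  have h := resultant_map_map (X ^ 2 - C (2 * z.re) * X + C (‖z‖ ^ 2)) R 2 R.natDegree
    (algebraMap ℝ ℂ)
  rw [hmap] at h
  have h2 := resultant_mul_left (X - C (starRingEnd ℂ z)) (X - C z) (R.map (algebraMap ℝ ℂ))
    R.natDegree (by simp)
  simp only [natDegree_X_sub_C, Nat.reduceAdd] at h2
  rw [h2, resultant_X_sub_C_left _ _ _ (by simp), resultant_X_sub_C_left _ _ _ (by simp)] at h
  rw [hd]
  apply (algebraMap ℝ ℂ).injective
  rw [← h]
  simp only [eval_map_algebraMap, aeval_conj]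
  rw [mul_comm, Complex.mul_conj']
  simp

theorem resultant_linear_mul_linear_pos {S : ℝ[X]} {a b : ℝ} (hab : a ≤ b)
    (hz : ∀ x ∈ Set.Ioo a b, S.eval x ≠ 0) (hc : IsCoprime ((X - C a) * (X - C b)) S) :
    0 < resultant ((X - C a) * (X - C b)) S := by
  rw [resultant_mul_left_of_monic _ _ _ (monic_X_sub_C a) (monic_X_sub_C b),
    resultant_X_sub_C_left_natDegree, resultant_X_sub_C_left_natDegree]
  refine eval_mul_eval_pos hab fun x hx => ?_
  rcases eq_or_lt_of_le hx.1 with rfl | h1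
  · exact eval_ne_zero_of_isCoprime hc (by simp)
  rcases eq_or_lt_of_le hx.2 with rfl | h2
  · exact eval_ne_zero_of_isCoprime hc (by simp)
  exact hz x ⟨h1, h2⟩

/-! ### Pascal's recursion for the signed count -/

/-- Pascal's recursion, for a quadratic factor `Q` with positive resultants and such that the
factorizations separating the roots of `Q` cancel. -/
theorem signedCount_quadratic_mul {Q τ : ℝ[X]} (hQ : Q.Monic) (hd : Q.natDegree = 2)
    (hτ : τ.Monic) (m : ℕ)
    (hco : ∀ x ∈ factorizations (Q * τ) (m + 2), IsCoprime x.1 x.2)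
    (hpos : ∀ S, S ∣ τ → IsCoprime Q S → 0 < resultant Q S)
    (hsplit : ∑ᶠ x ∈ {x ∈ factorizations (Q * τ) (m + 2) | ¬ Q ∣ x.1 ∧ ¬ Q ∣ x.2},
      resultantSign x = 0) :
    signedCount (Q * τ) (m + 2) = signedCount τ m + signedCount τ (m + 2) := by
  set F := factorizations (Q * τ) (m + 2) with hF
  have hfin : F.Finite := finite_factorizations (hQ.mul hτ).ne_zero _
  have hA := factorizations_mul_left (τ := τ) hQ hd m
  have hB := factorizations_mul_right (τ := τ) hQ (m + 2)
  rw [← hF] at hA hB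
  have hdecomp : F = ({x ∈ F | Q ∣ x.1} ∪ {x ∈ F | Q ∣ x.2}) ∪
      {x ∈ F | ¬ Q ∣ x.1 ∧ ¬ Q ∣ x.2} := by
    ext x; simp only [Set.mem_union, Set.mem_ofPred_eq]; tauto
  have hdisj : Disjoint {x ∈ F | Q ∣ x.1} {x ∈ F | Q ∣ x.2} :=
    Set.disjoint_left.2 fun x h1 h2 =>
      not_isCoprime_of_dvd (by omega) h1.2 h2.2 (hco x h1.1)
  have hdisj' : Disjoint ({x ∈ F | Q ∣ x.1} ∪ {x ∈ F | Q ∣ x.2})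
      {x ∈ F | ¬ Q ∣ x.1 ∧ ¬ Q ∣ x.2} :=
    Set.disjoint_left.2 fun x h1 h2 => h1.elim (fun h => h2.2.1 h.2) fun h => h2.2.2 h.2
  have fin (p : ℝ[X] × ℝ[X] → Prop) : {x ∈ F | p x}.Finite := hfin.subset (Set.sep_subset _ _)
  rw [signedCount, ← hF, hdecomp, finsum_mem_union hdisj' ((fin _).union (fin _)) (fin _), hsplit,
    add_zero, finsum_mem_union hdisj (fin _) (fin _)]
  congr 1
  · have hmem : ∀ x ∈ factorizations τ m, IsCoprime (Q * x.1) x.2 := fun x hx =>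
      hco (Q * x.1, x.2) (mul_left_mem_factorizations hQ hd hx)
    rw [hA, finsum_mem_image]
    · refine finsum_mem_congr rfl fun x hx => ?_
      have hc := hmem x hx
      obtain ⟨P, R⟩ := x
      obtain ⟨⟨hP, hR, h⟩, -⟩ := hx
      have hdvd : R ∣ τ := Dvd.intro_left P h
      exact resultantSign_mul_left hQ hP (hpos R hdvd hc.of_mul_left_left)
    · rintro ⟨p, q⟩ - ⟨p', q'⟩ - h
      simpa [hQ.ne_zero] using h
  · have hmem : ∀ x ∈ factorizations τ (m + 2), IsCoprime x.1 (Q * x.2) := fun x hx =>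
      hco (x.1, Q * x.2) (mul_right_mem_factorizations hQ hx)
    rw [hB, finsum_mem_image]
    · refine finsum_mem_congr rfl fun x hx => ?_
      have hc := hmem x hx
      obtain ⟨P, R⟩ := x
      obtain ⟨⟨hP, hR, h⟩, -⟩ := hx
      have hdvd : P ∣ τ := Dvd.intro R h
      exact resultantSign_mul_right hQ hR hd (hpos P hdvd hc.of_mul_right_left.symm)
    · rintro ⟨p, q⟩ - ⟨p', q'⟩ - h
      simpa [hQ.ne_zero] using h

/-- The factorizations in which neither factor is divisible by `(X - a) * (X - b)` are those that
separate the roots `a` and `b`. -/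
theorem split_factorizations {τ : ℝ[X]} (a b : ℝ) (m : ℕ)
    (hco : ∀ x ∈ factorizations ((X - C a) * (X - C b) * τ) (m + 2), IsCoprime x.1 x.2) :
    {x ∈ factorizations ((X - C a) * (X - C b) * τ) (m + 2) |
        ¬ (X - C a) * (X - C b) ∣ x.1 ∧ ¬ (X - C a) * (X - C b) ∣ x.2} =
      (fun x : ℝ[X] × ℝ[X] => ((X - C a) * x.1, (X - C b) * x.2)) '' factorizations τ (m + 1) ∪
      (fun x : ℝ[X] × ℝ[X] => ((X - C b) * x.1, (X - C a) * x.2)) '' factorizations τ (m + 1) := by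
  -- The factorizations whose first factor vanishes at `c`.
  have half (c d : ℝ) (p q : ℝ[X]) (hp : p.Monic) (hq : q.Monic)
      (h : p * q = (X - C c) * (X - C d) * τ) (hm : p.natDegree = m + 2)
      (h1 : ¬ (X - C c) * (X - C d) ∣ p) (h2 : X - C c ∣ p) :
      (p, q) ∈ (fun x : ℝ[X] × ℝ[X] => ((X - C c) * x.1, (X - C d) * x.2)) ''
        factorizations τ (m + 1) := by
    obtain ⟨P, rfl⟩ := h2
    have hP := (monic_X_sub_C c).of_mul_monic_left hp
    rw [mul_assoc, mul_assoc] at h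
    replace h := mul_left_cancel₀ (X_sub_C_ne_zero c) h
    rcases (prime_X_sub_C d).dvd_or_dvd (Dvd.intro _ h.symm) with h3 | ⟨R, rfl⟩
    · exact absurd (mul_dvd_mul_left _ h3) h1
    have hR := (monic_X_sub_C d).of_mul_monic_left hq
    rw [mul_left_comm] at h
    replace h := mul_left_cancel₀ (X_sub_C_ne_zero d) h
    rw [(monic_X_sub_C c).natDegree_mul hP, natDegree_X_sub_C] at hm
    exact ⟨(P, R), ⟨⟨hP, hR, h⟩, by simp only; omega⟩, rfl⟩
  ext ⟨p, q⟩
  constructor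
  · rintro ⟨⟨⟨hp, hq, h⟩, hm⟩, h1, h2⟩
    simp only at hp hq h hm h1 h2
    rcases (prime_X_sub_C a).dvd_or_dvd (a := p) (b := q) ⟨(X - C b) * τ, by rw [h, mul_assoc]⟩
      with h3 | h3
    · exact Or.inl (half a b p q hp hq h hm h1 h3)
    · obtain ⟨R, rfl⟩ := h3
      rw [mul_left_comm, mul_assoc] at h
      have h4 := mul_left_cancel₀ (X_sub_C_ne_zero a) h
      rcases (prime_X_sub_C b).dvd_or_dvd (Dvd.intro _ h4.symm) with h5 | h5
      · refine Or.inr (half b a p _ hp hq ?_ hm ?_ h5)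
        · rw [mul_left_comm, h]; ring
        · rwa [mul_comm (X - C b)]
      · exact absurd (mul_dvd_mul_left _ h5) h2
  · rintro (⟨x, hx, he⟩ | ⟨x, hx, he⟩)
    · have hmem := mul_mul_mem_factorizations a b hx
      have hc := hco _ hmem
      rw [← he]
      refine ⟨hmem, fun h => ?_, fun h => ?_⟩
      · exact not_isCoprime_of_dvd (Q := X - C b) (by simp) ((dvd_mul_left _ _).trans h)
          (dvd_mul_right _ _) hc
      · exact not_isCoprime_of_dvd (Q := X - C a) (by simp) (dvd_mul_right _ _)
          ((dvd_mul_right _ _).trans h) hc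
    · have hmem := mul_mul_mem_factorizations b a hx
      rw [mul_comm (X - C b)] at hmem
      have hc := hco _ hmem
      rw [← he]
      refine ⟨hmem, fun h => ?_, fun h => ?_⟩
      · exact not_isCoprime_of_dvd (Q := X - C a) (by simp) ((dvd_mul_right _ _).trans h)
          (dvd_mul_right _ _) hc
      · exact not_isCoprime_of_dvd (Q := X - C b) (by simp) (dvd_mul_right _ _)
          ((dvd_mul_left _ _).trans h) hc

theorem sum_split_eq_zero {τ : ℝ[X]} (hτ : τ.Monic) {a b : ℝ} (hab : a ≤ b)
    (hτz : ∀ x ∈ Set.Ioo a b, τ.eval x ≠ 0) (m : ℕ)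
    (hco : ∀ x ∈ factorizations ((X - C a) * (X - C b) * τ) (m + 2), IsCoprime x.1 x.2) :
    ∑ᶠ x ∈ {x ∈ factorizations ((X - C a) * (X - C b) * τ) (m + 2) |
        ¬ (X - C a) * (X - C b) ∣ x.1 ∧ ¬ (X - C a) * (X - C b) ∣ x.2},
      resultantSign x = 0 := by
  have hs := split_factorizations a b m hco
  have hfin := finite_factorizations hτ.ne_zero (m + 1)
  have hc1 : ∀ x ∈ factorizations τ (m + 1), IsCoprime ((X - C a) * x.1) ((X - C b) * x.2) :=
    fun x hx => hco ((X - C a) * x.1, (X - C b) * x.2) (mul_mul_mem_factorizations a b hx)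
  have hc2 : ∀ x ∈ factorizations τ (m + 1), IsCoprime ((X - C b) * x.1) ((X - C a) * x.2) :=
    fun x hx => hco ((X - C b) * x.1, (X - C a) * x.2) (mul_comm (X - C b) (X - C a) ▸
      mul_mul_mem_factorizations b a hx)
  have hinj (c d : ℝ) : Function.Injective
      (fun x : ℝ[X] × ℝ[X] => ((X - C c) * x.1, (X - C d) * x.2)) := by
    rintro ⟨p, q⟩ ⟨p', q'⟩ h
    simpa [X_sub_C_ne_zero] using h
  rw [hs, finsum_mem_union _ (hfin.image _) (hfin.image _), finsum_mem_image (hinj a b).injOn,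
    finsum_mem_image (hinj b a).injOn, ← finsum_mem_add_distrib hfin]
  · refine (finsum_mem_congr rfl fun x hx => ?_).trans (finsum_mem_zero _)
    have h1 := hc1 x hx
    have h2 := hc2 x hx
    obtain ⟨P, R⟩ := x
    obtain ⟨⟨hP, hR, h⟩, -⟩ := hx
    have hz (S : ℝ[X]) (hS : S ∣ τ) (y : ℝ) (hy : y ∈ Set.Ioo a b) : S.eval y ≠ 0 := fun h =>
      hτz y hy (eval_eq_zero_of_dvd_of_eval_eq_zero hS h)
    have hPd : P ∣ τ := Dvd.intro R h
    have hRd : R ∣ τ := Dvd.intro_left P h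
    exact resultantSign_swap hP hR hab (hz P hPd) (hz R hRd) h1 h2
  · refine Set.disjoint_left.2 ?_
    rintro _ ⟨x, hx, rfl⟩ ⟨y, hy, he⟩
    obtain ⟨-, he2⟩ := Prod.mk.inj he
    refine not_isCoprime_of_dvd (Q := X - C a) (by simp) (dvd_mul_right _ _) ?_ (hc1 x hx)
    rw [← he2]
    exact dvd_mul_right _ _

theorem signedCount_zero {ρ : ℝ[X]} (hρ : ρ.Monic) : signedCount ρ 0 = 1 := by
  have : factorizations ρ 0 = {(1, ρ)} := by
    ext ⟨p, q⟩
    simp only [factorizations, Set.mem_ofPred_eq, Set.mem_singleton_iff, Prod.mk.injEq]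
    constructor
    · rintro ⟨⟨hp, hq, h⟩, hm⟩
      obtain rfl := hp.natDegree_eq_zero.1 hm
      simpa using h
    · rintro ⟨rfl, rfl⟩
      simp [hρ, monic_one]
  rw [signedCount, this, finsum_mem_singleton, resultantSign]
  simp

/-! ### Quadratic factors of real polynomials -/

theorem exists_root_of_odd_natDegree {P : ℝ[X]} (hP : P.Monic) (h : Odd P.natDegree) :
    ∃ x, P.IsRoot x := by
  by_contra! hn
  have hlc : 0 ≤ P.leadingCoeff := by simp [hP.leadingCoeff]
  have h1 := zero_lt_eval_of_roots_lt_of_leadingCoeff_nonneg (x := 0)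
    (fun y hy => absurd hy (hn y)) hlc
  have h2 := zero_lt_negOnePow_mul_eval_of_lt_roots_of_leadingCoeff_nonneg (x := 0)
    (fun y hy => absurd hy (hn y)) hlc
  rw [Int.negOnePow_odd _ (by exact_mod_cast h)] at h2
  push_cast at h2
  linarith

theorem exists_minimal_root {P : ℝ[X]} (hP : P ≠ 0) (h : ∃ x, P.IsRoot x) :
    ∃ a, P.IsRoot a ∧ ∀ x, P.IsRoot x → a ≤ x := by
  obtain ⟨x, hx⟩ := h
  obtain ⟨a, ha, hmin⟩ := P.roots.toFinset.exists_min_image id ⟨x, by simpa [hP] using hx⟩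
  simp only [Multiset.mem_toFinset, mem_roots hP, id] at ha hmin
  exact ⟨a, ha, hmin⟩

/-- In the second alternative `a` and `b` are the two smallest real roots, with multiplicity. -/
theorem exists_quadratic_factor {ρ : ℝ[X]} (hρ : ρ.Monic) {n : ℕ} (hn : ρ.natDegree = 2 * (n + 1)) :
    (∃ (z : ℂ) (τ : ℝ[X]), z.im ≠ 0 ∧ ρ = (X ^ 2 - C (2 * z.re) * X + C (‖z‖ ^ 2)) * τ) ∨
    ∃ (a b : ℝ) (τ : ℝ[X]), a ≤ b ∧ (∀ x ∈ Set.Ioo a b, τ.eval x ≠ 0) ∧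
      ρ = (X - C a) * (X - C b) * τ := by
  by_cases h : ∃ x, ρ.IsRoot x
  · right
    -- After the smallest root `a` is split off, the odd degree of the cofactor gives the next root.
    obtain ⟨a, ha, hmin⟩ := exists_minimal_root hρ.ne_zero h
    obtain ⟨σ, rfl⟩ := dvd_iff_isRoot.2 ha
    have hσ := (monic_X_sub_C a).of_mul_monic_left hρ
    rw [(monic_X_sub_C a).natDegree_mul hσ, natDegree_X_sub_C] at hn
    obtain ⟨b, hb, hmin'⟩ := exists_minimal_root hσ.ne_zero
      (exists_root_of_odd_natDegree hσ ⟨n, by omega⟩)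
    obtain ⟨τ, rfl⟩ := dvd_iff_isRoot.2 hb
    refine ⟨a, b, τ, hmin b ?_, fun x hx h0 => hx.2.not_ge (hmin' x ?_), by ring⟩
    · simp
    · simp [h0]
  · left
    obtain ⟨z, hz⟩ := IsAlgClosed.exists_aeval_eq_zero ℂ ρ
      (by intro h0; rw [natDegree_eq_zero_iff_degree_le_zero.2 h0.le] at hn; omega)
    have him : z.im ≠ 0 := fun him => h ⟨z.re, by
      have hzr : z = algebraMap ℝ ℂ z.re := by apply Complex.ext <;> simp [him]
      rw [hzr, aeval_algebraMap_apply] at hz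
      simpa using hz⟩
    obtain ⟨τ, hτ⟩ := ρ.quadratic_dvd_of_aeval_eq_zero_im_ne_zero hz him
    exact ⟨z, τ, him, hτ⟩

theorem aeval_complexQuadratic (z w : ℂ) :
    aeval w (X ^ 2 - C (2 * z.re) * X + C (‖z‖ ^ 2) : ℝ[X]) =
      (w - (starRingEnd ℂ) z) * (w - z) := by
  have : (algebraMap ℝ ℂ) (‖z‖ ^ 2) = (starRingEnd ℂ) z * z := by
    rw [Complex.conj_mul']; simp
  simp only [map_add, map_sub, map_mul, map_pow, aeval_X, aeval_C] at this ⊢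
  rw [this]
  have h2 : (algebraMap ℝ ℂ) 2 * (algebraMap ℝ ℂ) z.re = z + (starRingEnd ℂ) z := by
    rw [Complex.add_conj]; simp
  rw [h2]
  ring

theorem irreducible_complexQuadratic {z : ℂ} (hz : z.im ≠ 0) :
    Irreducible (X ^ 2 - C (2 * z.re) * X + C (‖z‖ ^ 2)) := by
  have hd : (X ^ 2 - C (2 * z.re) * X + C (‖z‖ ^ 2)).natDegree = 2 := by compute_degree!
  refine irreducible_of_degree_le_three_of_not_isRoot (by rw [hd]; decide) fun x hx => ?_
  have h := aeval_complexQuadratic z (algebraMap ℝ ℂ x)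
  rw [aeval_algebraMap_apply, coe_aeval_eq_eval, hx.eq_zero, map_zero, eq_comm, mul_eq_zero,
    sub_eq_zero, sub_eq_zero] at h
  rcases h with h | h
  · exact hz (by simpa using (congrArg Complex.im h).symm)
  · exact hz (by simpa using (congrArg Complex.im h).symm)

/-! ### The mapping degree -/

theorem signedCount_eq_choose (n k : ℕ) {ρ : ℝ[X]} (hρ : ρ.Monic) (hn : ρ.natDegree = 2 * n)
    (hco : ∀ x ∈ factorizations ρ (2 * k), IsCoprime x.1 x.2) :
    signedCount ρ (2 * k) = n.choose k := by
  induction n generalizing k ρ with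
  | zero =>
    cases k with
    | zero => simpa using signedCount_zero hρ
    | succ k =>
      have : factorizations ρ (2 * (k + 1)) = ∅ := by
        refine Set.eq_empty_of_forall_notMem ?_
        rintro ⟨p, q⟩ ⟨⟨hp, hq, rfl⟩, hm⟩
        rw [hp.natDegree_mul hq] at hn
        simp only at hm hn
        omega
      simp [signedCount, this]
  | succ n ih =>
    cases k with
    | zero => simpa using signedCount_zero hρ
    | succ k =>
      -- The induction step, for a quadratic factor of either kind.
      have step (Q τ : ℝ[X]) (hQ : Q.Monic) (hd : Q.natDegree = 2) (h : ρ = Q * τ)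
          (hpos : ∀ S, S ∣ τ → IsCoprime Q S → 0 < resultant Q S)
          (hsplit : ∑ᶠ x ∈ {x ∈ factorizations (Q * τ) (2 * k + 2) | ¬ Q ∣ x.1 ∧ ¬ Q ∣ x.2},
            resultantSign x = 0) :
          signedCount ρ (2 * (k + 1)) = (n + 1).choose (k + 1) := by
        subst h
        have hτ := hQ.of_mul_monic_left hρ
        rw [hQ.natDegree_mul hτ, hd] at hn
        rw [mul_add_one, signedCount_quadratic_mul hQ hd hτ (2 * k) hco hpos hsplit,
          ih k hτ (by omega) fun x hx => ?_, ← mul_add_one,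
          ih (k + 1) hτ (by omega) fun x hx => ?_, Nat.choose_succ_succ]
        · push_cast; rfl
        · have := hco (x.1, Q * x.2) (mul_right_mem_factorizations hQ hx)
          exact this.of_mul_right_right
        · have := hco (Q * x.1, x.2) (mul_left_mem_factorizations hQ hd hx)
          exact this.of_mul_left_right
      rcases exists_quadratic_factor hρ hn with ⟨z, τ, hz, h⟩ | ⟨a, b, τ, hab, hz, h⟩
      · refine step _ τ (by monicity!) (by compute_degree!) h (fun S _ hS => ?_) ?_
        · rw [resultant_complexQuadratic]
          have : aeval z S ≠ 0 := fun h0 => by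
            obtain ⟨u, v, e⟩ := hS
            have := congrArg (aeval z) e
            rw [map_add, map_mul (aeval z) u, map_mul (aeval z) v, aeval_complexQuadratic, h0] at this
            simp at this
          positivity
        · refine (finsum_mem_congr (Set.eq_empty_of_forall_notMem ?_) fun _ _ => rfl).trans
            finsum_mem_empty
          rintro x ⟨hx, h1, h2⟩
          rcases (irreducible_complexQuadratic hz).prime.dvd_or_dvd
            (Dvd.intro _ hx.1.2.2.symm) with h3 | h3
          exacts [h1 h3, h2 h3]
      · have hQ := (monic_X_sub_C a).mul (monic_X_sub_C b)
        refine step _ τ hQ ?_ h (fun S hS hc => ?_) ?_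
        · rw [(monic_X_sub_C a).natDegree_mul (monic_X_sub_C b)]; simp
        · exact resultant_linear_mul_linear_pos hab (fun x hx h0 =>
            hz x hx (eval_eq_zero_of_dvd_of_eval_eq_zero hS h0)) hc
        · subst h
          exact sum_split_eq_zero (hQ.of_mul_monic_left hρ) hab hz _ hco

theorem jacobian_mul_ne_zero_iff (m n : ℕ) (x : MonicPoly m × MonicPoly n) :
    jacobian (prodChart m n) (chart (m + n)) (mul m n) x ≠ 0 ↔ IsCoprime x.1.1 x.2.1 := by
  rw [jacobian_mul, Ne, resultant_eq_zero_iff]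
  simp [x.1.2.1.ne_zero]

theorem exists_isRegularValue_mul (m n : ℕ) :
    ∃ z, IsRegularValue (prodChart m n) (chart (m + n)) (mul m n) z := by
  obtain ⟨ρ, hρ, hd, hsep⟩ : ∃ ρ : ℝ[X], ρ.Monic ∧ ρ.natDegree = m + n ∧ ρ.Separable := by
    rcases Nat.eq_zero_or_pos (m + n) with h | h
    · exact ⟨1, monic_one, by simp [h], separable_one⟩
    · refine ⟨X ^ (m + n) - C 1, monic_X_pow_sub_C _ h.ne', natDegree_X_pow_sub_C, ?_⟩
      exact separable_X_pow_sub_C 1 (by exact_mod_cast h.ne') one_ne_zero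
  refine ⟨⟨ρ, hρ, hd⟩, fun x hx => (jacobian_mul_ne_zero_iff m n x).2 ?_⟩
  have h : x.1.1 * x.2.1 = ρ := congrArg Subtype.val hx
  rw [← h] at hsep
  exact hsep.isCoprime

theorem image_fiber (m n : ℕ) (ρ : MonicPoly (m + n)) :
    (fun x : MonicPoly m × MonicPoly n => (x.1.1, x.2.1)) '' {x | mul m n x = ρ} =
      factorizations ρ.1 m := by
  ext ⟨p, q⟩
  constructor
  · rintro ⟨⟨⟨p, hp, hm⟩, ⟨q, hq, hn⟩⟩, hx, he⟩
    obtain ⟨rfl, rfl⟩ := Prod.mk.inj he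
    have h : p * q = ρ.1 := congrArg Subtype.val hx
    exact ⟨⟨hp, hq, h⟩, hm⟩
  · rintro ⟨⟨hp, hq, h⟩, hm⟩
    have hd := ρ.2.2
    simp only at hp hq h hm
    rw [← h, hp.natDegree_mul hq] at hd
    exact ⟨(⟨p, hp, hm⟩, ⟨q, hq, by omega⟩), Subtype.ext h, rfl⟩

theorem injective_val_prod (m n : ℕ) :
    Function.Injective (fun x : MonicPoly m × MonicPoly n => (x.1.1, x.2.1)) := by
  rintro ⟨p, q⟩ ⟨p', q'⟩ h
  obtain ⟨h1, h2⟩ := Prod.mk.inj h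
  exact Prod.ext (Subtype.ext h1) (Subtype.ext h2)

theorem hasMappingDegree_mul (k l : ℕ) :
    HasMappingDegree (prodChart (2 * k) (2 * l)) (chart (2 * k + 2 * l))
      (mul (2 * k) (2 * l)) ((k + l).choose k : ℤ) := by
  refine ⟨contDiff_inCharts_mul _ _, isProperMap_mul _ _,
    exists_isRegularValue_mul _ _, fun ρ hρ => ?_⟩
  have himg := image_fiber (2 * k) (2 * l) ρ
  have hfin : {x | mul (2 * k) (2 * l) x = ρ}.Finite :=
    Set.Finite.of_finite_image (himg ▸ finite_factorizations ρ.2.1.ne_zero _)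
      (injective_val_prod _ _).injOn
  refine ⟨hfin, ?_⟩
  rw [← finsum_mem_eq_finite_toFinset_sum]
  simp only [jacobian_mul]
  have hco : ∀ x ∈ factorizations ρ.1 (2 * k), IsCoprime x.1 x.2 := by
    rw [← himg]
    rintro _ ⟨x, hx, rfl⟩
    exact (jacobian_mul_ne_zero_iff _ _ x).1 (hρ x hx)
  have h := signedCount_eq_choose (k + l) k ρ.2.1 (by rw [ρ.2.2]; ring) hco
  rw [signedCount, ← himg, finsum_mem_image (injective_val_prod _ _).injOn] at h
  exact h

end MonicPoly

theorem proposition8p4 (k l : ℕ) :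
    IsProperMap (MonicPoly.mul (2 * k) (2 * l)) ∧
      HasMappingDegree (MonicPoly.prodChart (2 * k) (2 * l)) (MonicPoly.chart (2 * k + 2 * l))
        (MonicPoly.mul (2 * k) (2 * l)) ((k + l).choose k : ℤ) :=
  ⟨MonicPoly.isProperMap_mul _ _, MonicPoly.hasMappingDegree_mul k l⟩
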